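/- All graphs are finite, simple and undirected. In a connected graph $G$ with vertex set $V$, the betweenness of a vertex $x$ is $B_G(x)=\sum_{\{v,w\}}\sigma_{vw}(x)/\sigma_{vw}$, where the sum is over unordered pairs of distinct vertices, $\sigma_{vw}$ is the number of shortest paths between $v$ and $w$, and $\sigma_{vw}(x)$ is the number of those that contain $x$ as an internal vertex. The graph $G$ is betweenness-uniform if all its vertices have the same betweenness, and the betweenness of $G$ is the average $\frac{1}{|V|}\sum_{x\in V}B_G(x)$ of the betweenness of its vertices. Theorem. Let $G$ be a connected betweenness-uniform graph with betweenness $\alpha\le 9/10$. Then there is an integer $\ell\ge 0$ such that $\alpha=\ell/(\ell+1)$ and every connected component of the complement of $G$ is isomorphic to the star $K_{1,\ell}$. Moreover, the conjecture of Gago, Coroničová-Hurajová and Madaras is false: it is not the case that for every rational $q>3/4$ there exists a connected betweenness-uniform graph with betweenness $q$. -/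

import Mathlib

namespace SimpleGraph

variable {V : Type*}

/-- The set of shortest paths from `v` to `w` in `G`. -/
def shortestPaths (G : SimpleGraph V) (v w : V) : Set (G.Walk v w) :=
  {p | p.IsPath ∧ p.length = G.dist v w}

/-- The set of shortest paths from `v` to `w` that contain `x` as an internal vertex. -/
def shortestPathsThrough (G : SimpleGraph V) (x v w : V) : Set (G.Walk v w) :=
  {p | p ∈ G.shortestPaths v w ∧ x ∈ p.support ∧ x ≠ v ∧ x ≠ w}

theorem ncard_shortestPaths_comm (G : SimpleGraph V) (v w : V) :
    (G.shortestPaths v w).ncard = (G.shortestPaths w v).ncard := by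
  refine Set.ncard_congr (fun p _ => p.reverse) ?_ ?_ ?_
  · rintro p ⟨h1, h2⟩
    exact ⟨h1.reverse, by rw [Walk.length_reverse, h2, dist_comm]⟩
  · intro p q _ _ h
    simpa using congrArg Walk.reverse h
  · rintro p ⟨h1, h2⟩
    exact ⟨p.reverse, ⟨h1.reverse, by rw [Walk.length_reverse, h2, dist_comm]⟩, by simp⟩

theorem ncard_shortestPathsThrough_comm (G : SimpleGraph V) (x v w : V) :
    (G.shortestPathsThrough x v w).ncard = (G.shortestPathsThrough x w v).ncard := by
  refine Set.ncard_congr (fun p _ => p.reverse) ?_ ?_ ?_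
  · rintro p ⟨⟨h1, h2⟩, h3, h4, h5⟩
    exact ⟨⟨h1.reverse, by rw [Walk.length_reverse, h2, dist_comm]⟩, by simpa using h3, h5, h4⟩
  · intro p q _ _ h
    simpa using congrArg Walk.reverse h
  · rintro p ⟨⟨h1, h2⟩, h3, h4, h5⟩
    exact ⟨p.reverse, ⟨⟨h1.reverse, by rw [Walk.length_reverse, h2, dist_comm]⟩,
      by simpa using h3, h5, h4⟩, by simp⟩

/-- For an unordered pair `{v, w}`, the fraction of the shortest paths between `v` and `w` that
contain `x` as an internal vertex. -/
noncomputable def betweennessShare (G : SimpleGraph V) (x : V) (e : Sym2 V) : ℚ :=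
  Sym2.lift ⟨fun v w =>
    ((G.shortestPathsThrough x v w).ncard : ℚ) / ((G.shortestPaths v w).ncard : ℚ),
    fun v w => by
      beta_reduce
      rw [ncard_shortestPaths_comm G v w, ncard_shortestPathsThrough_comm G x v w]⟩ e

open Classical in
/-- The betweenness centrality of the vertex `x`: the sum of the above fractions over all
unordered pairs of distinct vertices. -/
noncomputable def vertexBetweenness [Fintype V] (G : SimpleGraph V) (x : V) : ℚ :=
  ∑ e : Sym2 V with ¬ e.IsDiag, G.betweennessShare x e

/-- The betweenness of a graph: the average of the betweenness of its vertices. -/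
noncomputable def graphBetweenness [Fintype V] (G : SimpleGraph V) : ℚ :=
  (∑ x : V, G.vertexBetweenness x) / (Fintype.card V : ℚ)

/-- All vertices have the same betweenness. -/
def IsBetweennessUniform [Fintype V] (G : SimpleGraph V) : Prop :=
  ∀ x y : V, G.vertexBetweenness x = G.vertexBetweenness y

end SimpleGraph

namespace SimpleGraph

/-! ### Shares of vertex pairs, and the bound on the diameter. -/

section Betweenness

open scoped Classical
open Finset

variable {V : Type*}

/-! Every pair $v,w$ contributes $d(v,w)-1$ to the total betweenness. A pair at distance at least 3
would push the total up to $n=|V|$, so $\alpha<1$ forces diameter at most 2 (`dist_le_two`).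
Everything can then be read off the complement $H$. A nonadjacent pair $e$ of $G$ gives share
$1/(n-|N(e)|)$ to each vertex outside $N(e)$, the union of the $H$-neighbourhoods of its ends. So
uniformity says that `localWeight`, the total of these weights over edges $e$ of $H$ with $x\in
N(e)$, is constant in $x$ (`vertexBetweenness_eq`), and $\alpha=|E(H)|/n$ (`sum_vertexBetweenness`).

Since $|E(H)|\le 9n/10$, some vertex of $H$ has degree at most 1. An isolated vertex has weight 0,
so then $H$ has no edges. A leaf lies in a star component (`degree_eq_one_of_adj_adj`) and has
weight $l/(n-l-1)$, where $l$ is the degree of the centre, so all such stars have the same size.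

Let $Q$ be the set of remaining vertices, all of degree at least 2. If $Q\ne\emptyset$, some vertex
of $Q$ has more than $l$ edges near it (`exists_lt_card_edgesNear`), which gives $n+3l\le(l+1)^2$
(`card_add_le_of_lt_card_edgesNear`). With $10|E(H)|\le 9n$ this makes $Q$ 2-regular
(`two_regular_of_card_bounds`). Then at most 4 edges are near a vertex of $Q$, so $l\le3$; this
forces $|Q|=3$, hence $l\le2$, and $n$ is too small. -/

theorem shortestPaths_nonempty {G : SimpleGraph V} (hG : G.Connected) (v w : V) :
    (G.shortestPaths v w).Nonempty := by
  obtain ⟨p, hp, hl⟩ := hG.exists_path_of_dist v w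
  exact ⟨p, hp, hl⟩

theorem betweennessShare_nonneg (G : SimpleGraph V) (x : V) (e : Sym2 V) :
    0 ≤ G.betweennessShare x e := by
  induction e with
  | _ v w => exact div_nonneg (Nat.cast_nonneg _) (Nat.cast_nonneg _)

variable [Fintype V]

theorem finite_shortestPaths (G : SimpleGraph V) (v w : V) : (G.shortestPaths v w).Finite :=
  (Set.toFinite {p : G.Walk v w | p.length = G.dist v w}).subset fun _ hp => hp.2

theorem Walk.IsPath.card_internal {G : SimpleGraph V} {v w : V} {p : G.Walk v w}
    (hp : p.IsPath) (hvw : v ≠ w) :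
    #{x | x ∈ p.support ∧ x ≠ v ∧ x ≠ w} + 1 = p.length := by
  have h1 : ({x | x ∈ p.support ∧ x ≠ v ∧ x ≠ w} : Finset V)
      = (p.support.toFinset.erase v).erase w := by
    ext x
    simp only [mem_filter, mem_univ, true_and, mem_erase, List.mem_toFinset]
    tauto
  have h2 : #p.support.toFinset = p.length + 1 := by
    rw [List.toFinset_card_of_nodup hp.support_nodup, Walk.length_support]
  have h3 : 0 < p.length := by
    rw [Nat.pos_iff_ne_zero]
    exact fun h => hvw (Walk.eq_of_length_eq_zero h)
  rw [h1, card_erase_of_mem (by simp [hvw.symm]), card_erase_of_mem (by simp), h2]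
  omega

/-- Count pairs (shortest path, internal vertex) in two ways: each shortest path has $d(v,w)-1$
internal vertices. -/
theorem sum_betweennessShare {G : SimpleGraph V} (hG : G.Connected) {v w : V} (hvw : v ≠ w) :
    ∑ x, G.betweennessShare x s(v, w) = (G.dist v w : ℚ) - 1 := by
  set F := (G.finite_shortestPaths v w).toFinset with hF
  have hN : (G.shortestPaths v w).ncard = #F := Set.ncard_eq_toFinset_card _ _
  have hpos : (0 : ℚ) < #F := by
    rw [← hN]
    exact_mod_cast (Set.ncard_pos (G.finite_shortestPaths v w)).2 (shortestPaths_nonempty hG v w)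
  have ht : ∀ x, (G.shortestPathsThrough x v w).ncard
      = #{p ∈ F | x ∈ p.support ∧ x ≠ v ∧ x ≠ w} := by
    intro x
    rw [← Set.ncard_coe_finset]
    congr 1
    ext p
    simp [shortestPathsThrough, hF]
  have hsum : ∑ x, (G.shortestPathsThrough x v w).ncard + #F = #F * G.dist v w := by
    simp only [ht, card_filter]
    rw [sum_comm, card_eq_sum_ones, ← sum_add_distrib, sum_mul]
    refine sum_congr rfl fun p hp => ?_
    have hp' : p ∈ G.shortestPaths v w := by simpa [hF] using hp
    rw [one_mul, ← hp'.2, ← hp'.1.card_internal hvw, card_filter]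
  have hq : (∑ x, ((G.shortestPathsThrough x v w).ncard : ℚ)) + #F = #F * G.dist v w := by
    exact_mod_cast hsum
  change ∑ x, ((G.shortestPathsThrough x v w).ncard : ℚ) / ((G.shortestPaths v w).ncard : ℚ) = _
  rw [← sum_div, hN, div_eq_iff hpos.ne']
  linarith

theorem betweennessShare_of_adj {G : SimpleGraph V} (hG : G.Connected) {v w : V}
    (h : G.Adj v w) (x : V) : G.betweennessShare x s(v, w) = 0 := by
  have h1 := sum_betweennessShare hG h.ne
  rw [dist_eq_one_iff_adj.2 h, Nat.cast_one, sub_self,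
    sum_eq_zero_iff_of_nonneg fun y _ => G.betweennessShare_nonneg y _] at h1
  exact h1 x (mem_univ x)

/-- A path of length 2 is determined by its midpoint. -/
theorem ncard_shortestPathsThrough_of_dist_eq_two {G : SimpleGraph V} {v w : V}
    (h : G.dist v w = 2) (x : V) :
    (G.shortestPathsThrough x v w).ncard = if G.Adj v x ∧ G.Adj x w then 1 else 0 := by
  have hvw : v ≠ w := by
    rintro rfl
    simp at h
  split_ifs with hx
  · rw [Set.ncard_eq_one]
    refine ⟨.cons hx.1 (.cons hx.2 .nil), ?_⟩
    ext p
    simp only [shortestPathsThrough, shortestPaths, Set.mem_ofPred_eq, h, Set.mem_singleton_iff]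
    constructor
    · rintro ⟨⟨-, h2⟩, h3, h4, h5⟩
      match p, h2, h3 with
      | .cons (v := b') a (.cons b .nil), _, h3 =>
        have : x = b' := by simpa [h4, h5] using h3
        subst this
        rfl
    · rintro rfl
      simp [hx.1.ne, hx.2.ne, hvw, hx.1.ne.symm]
  · rw [Set.ncard_eq_zero (Set.Finite.subset (G.finite_shortestPaths v w) fun _ hp => hp.1),
      Set.eq_empty_iff_forall_notMem]
    rintro p ⟨⟨-, h2⟩, h3, h4, h5⟩
    rw [h] at h2
    match p, h2, h3 with
    | .cons (v := b') a (.cons b .nil), _, h3 =>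
      have : x = b' := by simpa [h4, h5] using h3
      subst this
      exact hx ⟨a, b⟩

theorem betweennessShare_of_dist_eq_two {G : SimpleGraph V} (hG : G.Connected) {v w : V}
    (h : G.dist v w = 2) (x : V) :
    G.betweennessShare x s(v, w) =
      if G.Adj v x ∧ G.Adj x w then 1 / (#{y | G.Adj v y ∧ G.Adj y w} : ℚ) else 0 := by
  have hvw : v ≠ w := by
    rintro rfl
    simp at h
  have hs : ∀ y, G.betweennessShare y s(v, w) =
      (if G.Adj v y ∧ G.Adj y w then 1 else 0) / ((G.shortestPaths v w).ncard : ℚ) := by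
    intro y
    change ((G.shortestPathsThrough y v w).ncard : ℚ) / ((G.shortestPaths v w).ncard : ℚ) = _
    rw [ncard_shortestPathsThrough_of_dist_eq_two h]
    norm_cast
  have h1 := sum_betweennessShare hG hvw
  simp only [hs] at h1
  rw [← sum_div, h] at h1
  have hpos : (0 : ℚ) < (G.shortestPaths v w).ncard := by
    exact_mod_cast (Set.ncard_pos (G.finite_shortestPaths v w)).2 (shortestPaths_nonempty hG v w)
  rw [div_eq_iff hpos.ne'] at h1
  have h2 : (#{y | G.Adj v y ∧ G.Adj y w} : ℚ) = (G.shortestPaths v w).ncard := by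
    rw [card_filter]
    push_cast
    rw [h1]
    norm_num
  rw [hs, h2]
  split_ifs <;> simp

/-- If $d(v,w)\ge3$, the triangle inequality makes the pairs $vu$ and $wu$ contribute at least 1
together for each of the $n-2$ other vertices $u$. The pair $vw$ adds at least 2, so the total
reaches $n$. -/
theorem dist_le_two {G : SimpleGraph V} (hG : G.Connected)
    (h : ∑ x, G.vertexBetweenness x < Fintype.card V) (v w : V) : G.dist v w ≤ 2 := by
  by_contra! hd
  have hvw : v ≠ w := by
    rintro rfl
    simp at hd
  refine h.not_ge ?_
  simp only [vertexBetweenness]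
  rw [sum_comm]
  set f : Sym2 V → ℚ := fun e => ∑ x, G.betweennessShare x e
  have hf0 : ∀ e, 0 ≤ f e := fun e => sum_nonneg fun x _ => G.betweennessShare_nonneg x e
  have hf : ∀ {a b : V}, a ≠ b → f s(a, b) = (G.dist a b : ℚ) - 1 :=
    fun hab => sum_betweennessShare hG hab
  set T : Finset V := {u | u ≠ v ∧ u ≠ w} with hT
  have hTc : #T + 2 = Fintype.card V := by
    have : T = (univ.erase v).erase w := by
      ext u
      simp [hT, and_comm]
    have hc : 2 ≤ #(univ : Finset V) := by
      rw [← card_pair hvw]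
      exact card_le_card (subset_univ _)
    rw [this, card_erase_of_mem (by simp [hvw.symm]), card_erase_of_mem (by simp),
      ← card_univ]
    omega
  have hmem : ∀ u ∈ T, u ≠ v ∧ u ≠ w := fun u hu => by simpa [hT] using hu
  have hinj : ∀ a : V, Set.InjOn (fun u => s(a, u)) (T : Set V) := by
    intro a u _ u' _ huu
    exact Sym2.congr_right.1 huu
  have hd1 : Disjoint (T.image fun u => s(v, u)) (T.image fun u => s(w, u)) := by
    rw [Finset.disjoint_left]
    intro e he he'
    obtain ⟨u, hu, rfl⟩ := mem_image.1 he
    obtain ⟨u', hu', huu⟩ := mem_image.1 he'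
    have := hmem u hu
    simp only [Sym2.eq_iff] at huu
    rcases huu with ⟨h1, -⟩ | ⟨h1, -⟩
    · exact hvw h1.symm
    · exact this.2 h1.symm
  have hd2 : s(v, w) ∉ (T.image fun u => s(v, u)) ∪ (T.image fun u => s(w, u)) := by
    simp only [mem_union, mem_image, not_or, not_exists, not_and]
    refine ⟨fun u hu h => ?_, fun u hu h => ?_⟩
    · have := hmem u hu
      simp only [Sym2.eq_iff] at h
      grind
    · have := hmem u hu
      simp only [Sym2.eq_iff] at h
      grind
  have hsub : insert s(v, w) ((T.image fun u => s(v, u)) ∪ (T.image fun u => s(w, u)))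
      ⊆ (univ.filter fun e : Sym2 V => ¬ e.IsDiag) := by
    intro e he
    simp only [mem_insert, mem_union, mem_image] at he
    simp only [mem_filter, mem_univ, true_and]
    rcases he with rfl | ⟨u, hu, rfl⟩ | ⟨u, hu, rfl⟩
    · simpa using hvw
    · simpa using (hmem u hu).1.symm
    · simpa using (hmem u hu).2.symm
  refine le_trans ?_ (sum_le_sum_of_subset_of_nonneg hsub fun e _ _ => hf0 e)
  change _ ≤ ∑ e ∈ _, f e
  rw [sum_insert hd2, sum_union hd1, sum_image (hinj v), sum_image (hinj w), ← sum_add_distrib,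
    hf hvw, ← hTc]
  have hterm : ∀ u ∈ T, (1 : ℚ) ≤ f s(v, u) + f s(w, u) := by
    intro u hu
    rw [hf (hmem u hu).1.symm, hf (hmem u hu).2.symm]
    have h1 : G.dist v w ≤ G.dist v u + G.dist u w := hG.dist_triangle
    rw [G.dist_comm (u := u) (v := w)] at h1
    have : (3 : ℚ) ≤ G.dist v u + G.dist w u := by exact_mod_cast hd.trans_le h1
    linarith
  have h2 := card_nsmul_le_sum T _ 1 hterm
  have h3 : (3 : ℚ) ≤ G.dist v w := by exact_mod_cast hd
  simp only [nsmul_eq_mul, mul_one] at h2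
  push_cast
  linarith

end Betweenness

/-! ### Translation to the complement: betweenness as edge weights. -/

section EdgeNeighborhoods

open scoped Classical
open Finset

variable {V : Type*}

theorem dist_eq_two_of_compl_adj {G : SimpleGraph V} (hG : G.Connected)
    (hd : ∀ v w, G.dist v w ≤ 2) {v w : V} (h : Gᶜ.Adj v w) : G.dist v w = 2 := by
  have h0 : G.dist v w ≠ 0 := fun h0 => h.ne (hG.dist_eq_zero_iff.1 h0)
  have h1 : G.dist v w ≠ 1 := fun h1 => ((compl_adj _ _ _).1 h).2 (dist_eq_one_iff_adj.1 h1)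
  have := hd v w
  omega

variable [Fintype V] (H : SimpleGraph V)

/-- The vertices adjacent to at least one endpoint of `e`. -/
noncomputable def edgeNhd (e : Sym2 V) : Finset V := {x | ∃ v ∈ e, H.Adj v x}

/-- The edges with an endpoint adjacent to `x`. -/
noncomputable def edgesNear (x : V) : Finset (Sym2 V) := {e ∈ H.edgeFinset | x ∈ H.edgeNhd e}

/-- The inverse of the number of vertices adjacent to no endpoint of `e`. -/
noncomputable def edgeWeight (e : Sym2 V) : ℚ := 1 / ((Fintype.card V : ℚ) - #(H.edgeNhd e))

/-- The total weight of the edges with an endpoint adjacent to `x`. -/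
noncomputable def localWeight (x : V) : ℚ := ∑ e ∈ H.edgesNear x, H.edgeWeight e

variable {H}

theorem mem_edgeNhd {v w x : V} : x ∈ H.edgeNhd s(v, w) ↔ H.Adj v x ∨ H.Adj w x := by
  simp [edgeNhd]

theorem mem_edgesNear {v w x : V} :
    s(v, w) ∈ H.edgesNear x ↔ H.Adj v w ∧ (H.Adj v x ∨ H.Adj w x) := by
  simp [edgesNear, mem_edgeNhd]

theorem edgeNhd_mk (v w : V) :
    H.edgeNhd s(v, w) = H.neighborFinset v ∪ H.neighborFinset w := by
  ext x
  simp [mem_edgeNhd]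

/-- The ends of $e$ cause no exception: each is adjacent to the other in the complement, and neither
is a common neighbour in $G$. -/
theorem mem_edgeNhd_compl_iff {G : SimpleGraph V} {v w : V} (h : Gᶜ.Adj v w) (y : V) :
    y ∈ Gᶜ.edgeNhd s(v, w) ↔ ¬ (G.Adj v y ∧ G.Adj y w) := by
  rw [mem_edgeNhd, ← not_iff_not, not_not]
  simp only [compl_adj, not_or, not_and, not_not] at h ⊢
  constructor
  · rintro ⟨h1, h2⟩
    refine ⟨h1 ?_, (h2 ?_).symm⟩
    · rintro rfl
      exact h.2 (h2 h.1.symm).symm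
    · rintro rfl
      exact h.2 (h1 h.1)
  · exact fun ⟨h1, h2⟩ => ⟨fun _ => h1, fun _ => h2.symm⟩

theorem card_edgeNhd_compl_add {G : SimpleGraph V} {v w : V} (h : Gᶜ.Adj v w) :
    #{y | G.Adj v y ∧ G.Adj y w} + #(Gᶜ.edgeNhd s(v, w)) = Fintype.card V := by
  have : ({y | G.Adj v y ∧ G.Adj y w} : Finset V) = (Gᶜ.edgeNhd s(v, w))ᶜ := by
    ext y
    simp [mem_edgeNhd_compl_iff h]
  rw [this, card_compl_add_card]

/-- Ends at distance 2 in $G$ have a common neighbour. This makes all edge weights of the complement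
positive. -/
theorem card_edgeNhd_compl_lt {G : SimpleGraph V} (hG : G.Connected)
    (hd : ∀ v w, G.dist v w ≤ 2) {e : Sym2 V} (h : e ∈ Gᶜ.edgeSet) :
    #(Gᶜ.edgeNhd e) < Fintype.card V := by
  induction e with
  | _ v w =>
  rw [mem_edgeSet] at h
  have h2 := dist_eq_two_of_compl_adj hG hd h
  obtain ⟨p, -, hp⟩ := shortestPaths_nonempty hG v w
  rw [h2] at hp
  have : 0 < #{y | G.Adj v y ∧ G.Adj y w} := by
    rw [card_pos]
    match p, hp with
    | .cons (v := y) a (.cons b .nil), _ => exact ⟨y, by simp [a, b]⟩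
  have := card_edgeNhd_compl_add h
  omega

theorem betweennessShare_of_compl_adj {G : SimpleGraph V} (hG : G.Connected)
    (hd : ∀ v w, G.dist v w ≤ 2) {e : Sym2 V} (h : e ∈ Gᶜ.edgeSet) (x : V) :
    G.betweennessShare x e = if x ∈ Gᶜ.edgeNhd e then 0 else Gᶜ.edgeWeight e := by
  induction e with
  | _ v w =>
  rw [mem_edgeSet] at h
  rw [betweennessShare_of_dist_eq_two hG (dist_eq_two_of_compl_adj hG hd h), edgeWeight,
    ← card_edgeNhd_compl_add h]
  push_cast
  rw [add_sub_cancel_right]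
  simp only [mem_edgeNhd_compl_iff h, ite_not]

theorem edgeFinset_subset_not_isDiag (H : SimpleGraph V) :
    H.edgeFinset ⊆ (univ.filter fun e : Sym2 V => ¬ e.IsDiag) := by
  intro e he
  simpa using not_isDiag_of_mem_edgeSet _ (mem_edgeFinset.1 he)

/-- Only edges of $H$ have nonzero shares, and an edge gives $x$ its full weight unless it is near
$x$. -/
theorem vertexBetweenness_eq {G : SimpleGraph V} (hH : H = Gᶜ) (hG : G.Connected)
    (hd : ∀ v w, G.dist v w ≤ 2) (x : V) :
    G.vertexBetweenness x = ∑ e ∈ H.edgeFinset, H.edgeWeight e - H.localWeight x := by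
  have h1 : G.vertexBetweenness x = ∑ e ∈ H.edgeFinset, G.betweennessShare x e := by
    rw [vertexBetweenness]
    symm
    refine sum_subset_zero_on_sdiff H.edgeFinset_subset_not_isDiag ?_ fun _ _ => rfl
    intro e he
    induction e with
    | _ v w =>
    simp only [mem_sdiff, mem_filter, mem_univ, true_and, mem_edgeFinset, mem_edgeSet,
      Sym2.mk_isDiag_iff, hH, compl_adj, not_and, not_not] at he
    exact betweennessShare_of_adj hG (he.2 he.1) x
  rw [h1, localWeight, edgesNear, sum_filter, eq_sub_iff_add_eq, ← sum_add_distrib]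
  refine sum_congr rfl fun e he => ?_
  rw [mem_edgeFinset] at he
  subst hH
  rw [betweennessShare_of_compl_adj hG hd he]
  split_ifs <;> simp

theorem sum_vertexBetweenness {G : SimpleGraph V} (hH : H = Gᶜ) (hG : G.Connected)
    (hd : ∀ v w, G.dist v w ≤ 2) : ∑ x, G.vertexBetweenness x = #H.edgeFinset := by
  simp only [vertexBetweenness]
  rw [sum_comm, ← nsmul_one, ← sum_const]
  symm
  refine sum_subset_zero_on_sdiff H.edgeFinset_subset_not_isDiag ?_ ?_
  · intro e he
    induction e with
    | _ v w =>
    simp only [mem_sdiff, mem_filter, mem_univ, true_and, mem_edgeFinset, mem_edgeSet,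
      Sym2.mk_isDiag_iff, hH, compl_adj, not_and, not_not] at he
    exact sum_eq_zero fun x _ => betweennessShare_of_adj hG (he.2 he.1) x
  · intro e he
    induction e with
    | _ v w =>
    rw [mem_edgeFinset, mem_edgeSet] at he
    rw [sum_betweennessShare hG he.ne, dist_eq_two_of_compl_adj hG hd (hH ▸ he)]
    norm_num

end EdgeNeighborhoods

/-! ### Local weights, leaves and star components. -/

section LocalWeight

open scoped Classical
open Finset

variable {V : Type*} [Fintype V] {H : SimpleGraph V}

theorem edgesNear_eq_biUnion (x : V) :
    H.edgesNear x = (H.neighborFinset x).biUnion fun y => H.incidenceFinset y := by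
  ext e
  induction e with
  | _ v w =>
  simp only [mem_edgesNear, mem_biUnion, mem_neighborFinset, mem_incidenceFinset,
    mk'_mem_incidenceSet_iff]
  constructor
  · rintro ⟨h, h1 | h1⟩
    · exact ⟨v, h1.symm, h, .inl rfl⟩
    · exact ⟨w, h1.symm, h, .inr rfl⟩
  · rintro ⟨y, h1, h, rfl | rfl⟩
    · exact ⟨h, .inl h1.symm⟩
    · exact ⟨h, .inr h1.symm⟩

theorem edgesNear_subset_edgeFinset (x : V) : H.edgesNear x ⊆ H.edgeFinset := filter_subset _ _

theorem incidenceFinset_subset_edgesNear {x y : V} (h : H.Adj x y) :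
    H.incidenceFinset y ⊆ H.edgesNear x := by
  rw [edgesNear_eq_biUnion]
  exact subset_biUnion_of_mem (fun z => H.incidenceFinset z) ((H.mem_neighborFinset x y).2 h)

theorem incidenceFinset_self_subset_edgesNear (x : V) :
    H.incidenceFinset x ⊆ H.edgesNear x := by
  intro e he
  induction e with
  | _ v w =>
  rw [mem_incidenceFinset, mk'_mem_incidenceSet_iff] at he
  rw [mem_edgesNear]
  rcases he with ⟨h, rfl | rfl⟩
  · exact ⟨h, .inr h.symm⟩
  · exact ⟨h, .inl h⟩

theorem edgesNear_of_forall_adj {x y : V} (h : H.Adj x y) (hx : ∀ z, H.Adj x z → z = y) :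
    H.edgesNear x = H.incidenceFinset y := by
  have : H.neighborFinset x = {y} := by
    ext z
    simp only [mem_neighborFinset, mem_singleton]
    exact ⟨hx z, fun hz => hz ▸ h⟩
  rw [edgesNear_eq_biUnion, this, singleton_biUnion]

theorem eq_of_degree_eq_one {x y z : V} (hx : H.degree x = 1) (hy : H.Adj x y)
    (hz : H.Adj x z) : z = y :=
  (degree_eq_one_iff_existsUnique_adj.1 hx).unique hz hy

theorem degree_eq_one_of_forall {x y : V} (hy : H.Adj x y) (h : ∀ z, H.Adj x z → z = y) :
    H.degree x = 1 :=
  degree_eq_one_iff_existsUnique_adj.2 ⟨y, hy, h⟩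

theorem edgeWeight_pos {e : Sym2 V} (h : #(H.edgeNhd e) < Fintype.card V) :
    0 < H.edgeWeight e :=
  one_div_pos.2 (sub_pos.2 (by exact_mod_cast h))

theorem localWeight_eq_zero_iff (hc : ∀ e ∈ H.edgeSet, #(H.edgeNhd e) < Fintype.card V) {x : V} :
    H.localWeight x = 0 ↔ H.degree x = 0 := by
  have hpos : ∀ e ∈ H.edgesNear x, 0 < H.edgeWeight e := fun e he =>
    edgeWeight_pos (hc e (mem_edgeFinset.1 (edgesNear_subset_edgeFinset x he)))
  constructor
  · intro h
    rw [localWeight, sum_eq_zero_iff_of_nonneg fun e he => (hpos e he).le] at h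
    by_contra hne
    obtain ⟨y, hy⟩ := (H.degree_pos_iff_exists_adj x).1 (Nat.pos_of_ne_zero hne)
    have he : s(x, y) ∈ H.edgesNear x := mem_edgesNear.2 ⟨hy, .inr hy.symm⟩
    exact (hpos _ he).ne' (h _ he)
  · intro h
    rw [localWeight, edgesNear_eq_biUnion]
    rw [← card_neighborFinset_eq_degree, card_eq_zero] at h
    rw [h, biUnion_empty, sum_empty]

/-- The edges near the leaf $x$ are exactly those at $y$, and all of them are near $y$ too. A
further edge $zt$ with $t\ne y$ would be near $y$ with positive weight, making the local weight of
$y$ strictly larger. -/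
theorem degree_eq_one_of_adj_adj (hc : ∀ e ∈ H.edgeSet, #(H.edgeNhd e) < Fintype.card V)
    {x y z : V} (hS : H.localWeight x = H.localWeight y) (hx : H.degree x = 1)
    (hxy : H.Adj x y) (hyz : H.Adj y z) : H.degree z = 1 := by
  refine degree_eq_one_of_forall hyz.symm fun t ht => ?_
  by_contra hty
  have hE := edgesNear_of_forall_adj hxy fun z => eq_of_degree_eq_one hx hxy
  refine hS.not_lt ?_
  rw [localWeight, localWeight, hE]
  have hzt : s(z, t) ∈ H.edgesNear y := mem_edgesNear.2 ⟨ht, .inl hyz.symm⟩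
  have hpos : ∀ e ∈ H.edgesNear y, 0 < H.edgeWeight e := fun e he =>
    edgeWeight_pos (hc e (mem_edgeFinset.1 (edgesNear_subset_edgeFinset y he)))
  refine sum_lt_sum_of_subset (incidenceFinset_self_subset_edgesNear y) hzt ?_ (hpos _ hzt)
    fun e he _ => (hpos e he).le
  rw [mem_incidenceFinset, mk'_mem_incidenceSet_iff]
  rintro ⟨-, h | h⟩
  · exact hyz.ne h
  · exact hty h.symm

theorem card_edgeNhd_of_degree_eq_one {y z : V} (hyz : H.Adj y z) (hz : H.degree z = 1) :
    #(H.edgeNhd s(y, z)) = H.degree y + 1 := by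
  have h1 : H.edgeNhd s(y, z) = insert y (H.neighborFinset y) := by
    ext t
    simp only [mem_edgeNhd, mem_insert, mem_neighborFinset]
    constructor
    · rintro (h | h)
      · exact .inr h
      · exact .inl (eq_of_degree_eq_one hz hyz.symm h)
    · rintro (rfl | h)
      · exact .inr hyz.symm
      · exact .inl h
  rw [h1, card_insert_of_notMem (by simp), card_neighborFinset_eq_degree]

theorem localWeight_of_degree_eq_one {x y : V} (hx : H.degree x = 1) (hxy : H.Adj x y)
    (hy : ∀ z, H.Adj y z → H.degree z = 1) :
    H.localWeight x = H.degree y / ((Fintype.card V : ℚ) - H.degree y - 1) := by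
  have hE := edgesNear_of_forall_adj hxy fun z => eq_of_degree_eq_one hx hxy
  have h : ∀ e ∈ H.incidenceFinset y,
      H.edgeWeight e = 1 / ((Fintype.card V : ℚ) - H.degree y - 1) := by
    intro e he
    obtain ⟨z, hz, rfl⟩ : ∃ z, H.Adj y z ∧ e = s(y, z) := by
      induction e with
      | _ v w =>
      rw [mem_incidenceFinset, mk'_mem_incidenceSet_iff] at he
      rcases he with ⟨h, rfl | rfl⟩
      · exact ⟨_, h, rfl⟩
      · exact ⟨_, h.symm, Sym2.eq_swap⟩
    rw [edgeWeight, card_edgeNhd_of_degree_eq_one hz (hy z hz)]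
    push_cast
    rw [sub_sub]
  rw [localWeight, hE, sum_congr rfl h, sum_const, card_incidenceFinset_eq_degree, nsmul_eq_mul,
    mul_one_div]

theorem sum_localWeight :
    ∑ x, H.localWeight x = ∑ e ∈ H.edgeFinset, #(H.edgeNhd e) * H.edgeWeight e := by
  simp only [localWeight, edgesNear, sum_filter]
  rw [sum_comm]
  refine sum_congr rfl fun e _ => ?_
  rw [← sum_filter, sum_const, nsmul_eq_mul]
  simp

/-! ### Unions of components of minimum degree two. -/

theorem mem_of_mem_edgesNear {Q : Finset V} (hQ : ∀ x ∈ Q, ∀ y, H.Adj x y → y ∈ Q) {x a b : V}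
    (hx : x ∈ Q) (h : s(a, b) ∈ H.edgesNear x) : a ∈ Q ∧ b ∈ Q ∧ H.Adj a b := by
  obtain ⟨hab, h | h⟩ := mem_edgesNear.1 h
  · have := hQ x hx a h.symm
    exact ⟨this, hQ a this b hab, hab⟩
  · have := hQ x hx b h.symm
    exact ⟨hQ b this a hab.symm, this, hab⟩

theorem exists_adj_ne {x : V} (h : 2 ≤ H.degree x) (y : V) : ∃ z, H.Adj x z ∧ z ≠ y := by
  rw [← card_neighborFinset_eq_degree] at h
  obtain ⟨z, hz, hne⟩ := exists_mem_ne h y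
  exact ⟨z, by simpa using hz, hne⟩

/-- There are $\deg u+\deg v-1$ edges at $u$ or $v$, all near $u$. A common neighbour of $u$ and $v$
lowers $|N(uv)|$ to at most this number; without one, an edge $yt$ from another neighbour $y$ of $u$
supplies the missing edge. -/
theorem card_edgeNhd_le_card_edgesNear {u v : V} (huv : H.Adj u v) (hu : 2 ≤ H.degree u)
    (hdeg : ∀ y, H.Adj u y → 2 ≤ H.degree y) : #(H.edgeNhd s(u, v)) ≤ #(H.edgesNear u) := by
  have hI : #(H.incidenceFinset u ∪ H.incidenceFinset v) + 1 = H.degree u + H.degree v := by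
    have h1 : H.incidenceFinset u ∩ H.incidenceFinset v = {s(u, v)} := by
      have := incidenceSet_inter_incidenceSet_of_adj H huv
      ext e
      have he := Set.ext_iff.1 this e
      simpa using he
    have := card_union_add_card_inter (H.incidenceFinset u) (H.incidenceFinset v)
    rwa [h1, card_singleton, card_incidenceFinset_eq_degree, card_incidenceFinset_eq_degree]
      at this
  have hsub : H.incidenceFinset u ∪ H.incidenceFinset v ⊆ H.edgesNear u :=
    union_subset (incidenceFinset_self_subset_edgesNear u) (incidenceFinset_subset_edgesNear huv)
  rw [edgeNhd_mk]
  have hN := card_union_add_card_inter (H.neighborFinset u) (H.neighborFinset v)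
  simp only [card_neighborFinset_eq_degree] at hN
  by_cases hcap : (H.neighborFinset u ∩ H.neighborFinset v).Nonempty
  · have := card_pos.2 hcap
    have := card_le_card hsub
    omega
  · obtain ⟨y, huy, hyv⟩ := exists_adj_ne hu v
    obtain ⟨t, hyt, htu⟩ := exists_adj_ne (hdeg y huy) u
    have htv : t ≠ v := by
      rintro rfl
      exact hcap ⟨y, by simp [huy, hyt.symm]⟩
    have hmem : s(y, t) ∈ H.edgesNear u := mem_edgesNear.2 ⟨hyt, .inl huy.symm⟩
    have hnot : s(y, t) ∉ H.incidenceFinset u ∪ H.incidenceFinset v := by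
      simp only [mem_union, mem_incidenceFinset, mk'_mem_incidenceSet_iff]
      have := huy.ne
      grind
    have := card_le_card (insert_subset hmem hsub)
    rw [card_insert_of_notMem hnot] at this
    omega

theorem exists_lt_card_edgesNear {Q : Finset V} (hne : Q.Nonempty) (hQ : ∀ x ∈ Q, ∀ y, H.Adj x y → y ∈ Q)
    (hdeg : ∀ x ∈ Q, 2 ≤ H.degree x) {l : ℕ} (hl : l + 1 < Fintype.card V)
    (hS : ∀ x, H.localWeight x = l / ((Fintype.card V : ℚ) - l - 1)) :
    ∃ x ∈ Q, l < #(H.edgesNear x) := by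
  have hP : ((Q ×ˢ Q).filter fun p => H.Adj p.1 p.2).Nonempty := by
    obtain ⟨x, hx⟩ := hne
    obtain ⟨y, hxy, -⟩ := exists_adj_ne (hdeg x hx) x
    exact ⟨(x, y), by simp [hx, hxy, hQ x hx y hxy]⟩
  -- With $|N(uv)|$ maximal, having at most $l$ edges near $u$ bounds every neighbourhood size in
  -- $Q$ by $l$. The local weight of $u$ is then at most $l/(n-l)$, below the prescribed
  -- $l/(n-l-1)$.
  obtain ⟨⟨u, v⟩, huv, hmax⟩ := exists_max_image _ (fun p => #(H.edgeNhd s(p.1, p.2))) hP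
  simp only [mem_filter, mem_product, and_imp, Prod.forall] at huv hmax
  obtain ⟨⟨hu, -⟩, huv⟩ := huv
  refine ⟨u, hu, ?_⟩
  by_contra! hk
  have hs : #(H.edgeNhd s(u, v)) ≤ l :=
    (card_edgeNhd_le_card_edgesNear huv (hdeg u hu) fun y hy => hdeg y (hQ u hu y hy)).trans hk
  have hlq : (l : ℚ) + 1 < Fintype.card V := by exact_mod_cast hl
  have hle : ∀ e ∈ H.edgesNear u, H.edgeWeight e ≤ 1 / ((Fintype.card V : ℚ) - l) := by
    intro e he
    induction e with
    | _ a b =>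
    obtain ⟨ha, hb, hab⟩ := mem_of_mem_edgesNear hQ hu he
    have : (#(H.edgeNhd s(a, b)) : ℚ) ≤ l := by exact_mod_cast (hmax a b ha hb hab).trans hs
    exact one_div_le_one_div_of_le (by linarith) (by linarith)
  have h1 := sum_le_card_nsmul _ _ _ hle
  change H.localWeight u ≤ _ at h1
  have hkq : (#(H.edgesNear u) : ℚ) ≤ l := by exact_mod_cast hk
  have hlpos : (0 : ℚ) < l := by
    have : 0 < #(H.edgeNhd s(u, v)) := card_pos.2 ⟨u, mem_edgeNhd.2 (.inr huv.symm)⟩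
    exact_mod_cast this.trans_le hs
  rw [hS, nsmul_eq_mul, mul_one_div] at h1
  have h2 : (#(H.edgesNear u) : ℚ) / ((Fintype.card V : ℚ) - l)
      ≤ l / ((Fintype.card V : ℚ) - l) := by
    gcongr
    linarith
  have h3 : (l : ℚ) / ((Fintype.card V : ℚ) - l) < l / ((Fintype.card V : ℚ) - l - 1) :=
    div_lt_div_of_pos_left hlpos (by linarith) (by linarith)
  linarith

theorem three_le_card_edgeNhd {a b : V} (hab : H.Adj a b) (ha : 2 ≤ H.degree a) :
    3 ≤ #(H.edgeNhd s(a, b)) := by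
  have h1 : insert a (H.neighborFinset a) ⊆ H.edgeNhd s(a, b) := by
    intro t ht
    rw [mem_insert, mem_neighborFinset] at ht
    rw [mem_edgeNhd]
    rcases ht with rfl | h
    · exact .inr hab.symm
    · exact .inl h
  have := card_le_card h1
  rw [card_insert_of_notMem (by simp), card_neighborFinset_eq_degree] at this
  omega

/-- Each edge near $x$ has weight at least $1/(n-3)$, since its neighbourhood has at least 3
vertices. Hence $(l+1)/(n-3)\le l/(n-l-1)$; clear denominators. -/
theorem card_add_le_of_lt_card_edgesNear
    (hc : ∀ e ∈ H.edgeSet, #(H.edgeNhd e) < Fintype.card V)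
    {Q : Finset V} (hQ : ∀ x ∈ Q, ∀ y, H.Adj x y → y ∈ Q)
    (hdeg : ∀ x ∈ Q, 2 ≤ H.degree x) {l : ℕ} (hl : l + 1 < Fintype.card V) {x : V} (hx : x ∈ Q)
    (hS : H.localWeight x = l / ((Fintype.card V : ℚ) - l - 1)) (hk : l < #(H.edgesNear x)) :
    Fintype.card V + 3 * l ≤ (l + 1) ^ 2 := by
  have hlq : (l : ℚ) + 1 < Fintype.card V := by exact_mod_cast hl
  have hn : (3 : ℚ) < Fintype.card V := by
    obtain ⟨y, hy, -⟩ := exists_adj_ne (hdeg x hx) x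
    exact_mod_cast (three_le_card_edgeNhd hy (hdeg x hx)).trans_lt (hc _ hy)
  have hle : ∀ e ∈ H.edgesNear x, 1 / ((Fintype.card V : ℚ) - 3) ≤ H.edgeWeight e := by
    intro e he
    induction e with
    | _ a b =>
    obtain ⟨ha, hb, hab⟩ := mem_of_mem_edgesNear hQ hx he
    have h1 : (3 : ℚ) ≤ #(H.edgeNhd s(a, b)) := by
      exact_mod_cast three_le_card_edgeNhd hab (hdeg a ha)
    have h2 : (#(H.edgeNhd s(a, b)) : ℚ) < Fintype.card V := by exact_mod_cast hc s(a, b) hab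
    exact one_div_le_one_div_of_le (by linarith) (by linarith)
  have h1 := card_nsmul_le_sum _ _ _ hle
  change _ ≤ H.localWeight x at h1
  rw [hS, nsmul_eq_mul, mul_one_div, div_le_div_iff₀ (by linarith) (by linarith)] at h1
  have hkq : (l : ℚ) + 1 ≤ #(H.edgesNear x) := by exact_mod_cast hk
  have h2 := mul_le_mul_of_nonneg_right hkq (by linarith : 0 ≤ (Fintype.card V : ℚ) - l - 1)
  have h3 : (Fintype.card V : ℚ) + 3 * l ≤ (l + 1) ^ 2 := by nlinarith
  exact_mod_cast h3

theorem card_edgesNear_le_of_degree_eq_two {x : V} (hx : H.degree x = 2)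
    (h : ∀ y, H.Adj x y → H.degree y = 2) : #(H.edgesNear x) ≤ 4 := by
  rw [edgesNear_eq_biUnion]
  refine card_biUnion_le.trans ?_
  rw [sum_congr rfl fun y hy => (H.card_incidenceFinset_eq_degree y).trans
    (h y ((H.mem_neighborFinset x y).1 hy)), sum_const, card_neighborFinset_eq_degree, hx]
  rfl

theorem card_edgesNear_le_of_card_eq_three {Q : Finset V}
    (hQ : ∀ x ∈ Q, ∀ y, H.Adj x y → y ∈ Q) (h : #Q = 3) {x : V} (hx : x ∈ Q) :
    #(H.edgesNear x) ≤ 3 := by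
  obtain ⟨a, b, c, -, -, -, rfl⟩ := card_eq_three.1 h
  refine (card_le_card (t := {s(a, b), s(a, c), s(b, c)}) fun e he => ?_).trans card_le_three
  induction e with
  | _ u v =>
  obtain ⟨hu, hv, huv⟩ := mem_of_mem_edgesNear hQ hx he
  have := huv.ne
  simp only [mem_insert, mem_singleton, Sym2.eq_iff] at hu hv ⊢
  grind

end LocalWeight

/-! ### Star components and the classification of the complement. -/

section Stars

open scoped Classical
open Finset

theorem nonempty_iso_completeBipartiteGraph {W : Type*} {K : SimpleGraph W} {c : W} {l : ℕ}
    (hK : ∀ a b, K.Adj a b ↔ (a = c ∧ b ≠ c) ∨ (a ≠ c ∧ b = c))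
    (hl : Nonempty ({a // a ≠ c} ≃ Fin l)) :
    Nonempty (K ≃g completeBipartiteGraph (Fin 1) (Fin l)) := by
  obtain ⟨g⟩ := hl
  let f : W ≃ Fin 1 ⊕ Fin l := (Equiv.sumCompl fun a => a = c).symm.trans
    (Equiv.sumCongr (Equiv.ofUnique {a // a = c} (Fin 1)) g)
  have hf1 : ∀ a, a = c → (f a).isLeft = true ∧ (f a).isRight = false := by
    intro a ha
    simp [f, Equiv.sumCompl, ha]
  have hf2 : ∀ a, a ≠ c → (f a).isLeft = false ∧ (f a).isRight = true := by
    intro a ha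
    simp [f, Equiv.sumCompl, ha]
  refine ⟨⟨f, ?_⟩⟩
  intro a b
  rw [hK, completeBipartiteGraph_adj]
  by_cases ha : a = c <;> by_cases hb : b = c
  · simp only [hf1 a ha, hf1 b hb]
    simp [ha, hb]
  · simp only [hf1 a ha, hf2 b hb]
    simp [ha, hb]
  · simp only [hf2 a ha, hf1 b hb]
    simp [ha, hb]
  · simp only [hf2 a ha, hf2 b hb]
    simp [ha, hb]

theorem ConnectedComponent.nonempty_iso_star {V : Type*} [Fintype V] {H : SimpleGraph V} {c : V}
    (hc : ∀ x, H.Adj c x → H.degree x = 1) :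
    Nonempty ((H.connectedComponentMk c).toSimpleGraph ≃g
      completeBipartiteGraph (Fin 1) (Fin (H.degree c))) := by
  have hleaf : ∀ x, H.Adj c x → ∀ y, H.Adj x y → y = c := fun x hx y hy =>
    (degree_eq_one_iff_existsUnique_adj.1 (hc x hx)).unique hy hx.symm
  have hreach : ∀ x, H.Reachable c x → x = c ∨ H.Adj c x := by
    rintro x ⟨p⟩
    have key : ∀ {u v : V}, H.Walk u v → u = c ∨ H.Adj c u → v = c ∨ H.Adj c v := by
      intro u v p
      induction p with
      | nil => exact id
      | cons h _ ih =>
        rintro (rfl | hu)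
        · exact ih (.inr h)
        · exact ih (.inl (hleaf _ hu _ h))
    exact key p (.inl rfl)
  have hsupp : ∀ x, x ∈ H.connectedComponentMk c ↔ x = c ∨ H.Adj c x := by
    intro x
    change H.connectedComponentMk x = H.connectedComponentMk c ↔ _
    rw [ConnectedComponent.eq]
    refine ⟨fun h => hreach x h.symm, ?_⟩
    rintro (rfl | h)
    · rfl
    · exact h.reachable.symm
  refine nonempty_iso_completeBipartiteGraph
    (c := (⟨c, (hsupp c).2 (.inl rfl)⟩ : H.connectedComponentMk c)) ?_ ?_
  · rintro ⟨a, ha⟩ ⟨b, hb⟩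
    have ha' := (hsupp a).1 ha
    have hb' := (hsupp b).1 hb
    simp only [ConnectedComponent.toSimpleGraph, comap_adj, ne_eq, Subtype.mk.injEq,
      Function.Embedding.subtype_apply]
    constructor
    · intro h
      rcases ha' with rfl | ha'
      · exact .inl ⟨rfl, h.ne'⟩
      · exact .inr ⟨ha'.ne', hleaf a ha' b h⟩
    · rintro (⟨rfl, h⟩ | ⟨h, rfl⟩)
      · exact hb'.resolve_left h
      · exact (ha'.resolve_left h).symm
  · have hcard : Fintype.card (H.neighborSet c) = H.degree c := H.card_neighborSet_eq_degree c
    refine ⟨Equiv.trans ?_ (Fintype.equivFinOfCardEq hcard)⟩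
    exact {
      toFun := fun x => ⟨x.1.1, ((hsupp _).1 x.1.2).resolve_left fun h => x.2 (Subtype.ext h)⟩
      invFun := fun x => ⟨⟨x.1, (hsupp _).2 (.inr x.2)⟩, fun h =>
        (H.ne_of_adj x.2) (congrArg Subtype.val h).symm⟩
      left_inv := fun _ => rfl
      right_inv := fun _ => rfl }

theorem card_degree_eq_one_eq_mul {V : Type*} [Fintype V] {H : SimpleGraph V} {l : ℕ}
    (hstar : ∀ x y z, H.degree x = 1 → H.Adj x y → H.Adj y z → H.degree z = 1)
    (hdeg : ∀ x y, H.degree x = 1 → H.Adj x y → H.degree y = l) :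
    #{x | H.degree x = 1} = #{y | ∃ x, H.degree x = 1 ∧ H.Adj x y} * l := by
  have h := sum_card_bipartiteAbove_eq_sum_card_bipartiteBelow (fun x y => H.Adj x y)
    (s := ({x | H.degree x = 1} : Finset V))
    (t := ({y | ∃ x, H.degree x = 1 ∧ H.Adj x y} : Finset V))
  have h1 : ∀ x ∈ ({x | H.degree x = 1} : Finset V), #(bipartiteAbove (fun x y => H.Adj x y)
      ({y | ∃ x, H.degree x = 1 ∧ H.Adj x y} : Finset V) x) = 1 := by
    intro x hx
    rw [mem_filter] at hx
    refine Eq.trans ?_ ((H.card_neighborFinset_eq_degree x).trans hx.2)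
    congr 1
    ext y
    simp only [bipartiteAbove, mem_filter, mem_univ, true_and, mem_neighborFinset]
    exact ⟨fun h => h.2, fun h => ⟨⟨x, hx.2, h⟩, h⟩⟩
  have h2 : ∀ y ∈ ({y | ∃ x, H.degree x = 1 ∧ H.Adj x y} : Finset V),
      #(bipartiteBelow (fun x y => H.Adj x y) ({x | H.degree x = 1} : Finset V) y) = l := by
    intro y hy
    obtain ⟨-, x, hx, hxy⟩ := mem_filter.1 hy
    refine Eq.trans ?_ ((H.card_neighborFinset_eq_degree y).trans (hdeg x y hx hxy))
    congr 1
    ext z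
    simp only [bipartiteBelow, mem_filter, mem_univ, true_and, mem_neighborFinset]
    exact ⟨fun h => h.2.symm, fun h => ⟨hstar x y z hx hxy h, h.symm⟩⟩
  rw [sum_congr rfl h1, sum_congr rfl h2, sum_const, sum_const] at h
  simpa using h

/-- Here $a$ is the number of stars, $q=|Q|$ and $R$ the degree sum over $Q$. The edge bound gives
$al+q\le9a$, so $a>0$ and $l<9$; the bound on $n$ with $q\ge3$ gives $a\le l-2$. As $R$ is even,
$R>2q$ would need $a(9-l)\ge q+10\ge13$, but $(l-2)(9-l)\le12$ for integer $l$. -/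
theorem two_regular_of_card_bounds {l n m a q R : ℕ} (hn : n = a * (l + 1) + q)
    (hm : 2 * m = 2 * (a * l) + R) (hR : 2 * q ≤ R) (hmn : 10 * m ≤ 9 * n)
    (hnl : n + 3 * l ≤ (l + 1) ^ 2) (hq : 3 ≤ q) : R = 2 * q ∧ (l ≤ 3 → q = 3) := by
  have h1 : a * l + q ≤ 9 * a := by
    rw [mul_add] at hn
    omega
  have hl : l < 9 := by
    by_contra! h
    have := Nat.mul_le_mul_left a h
    omega
  interval_cases l <;> omega

theorem stars_of_localWeight_eq {V : Type*} [Fintype V] [Nonempty V] {H : SimpleGraph V}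
    (hc : ∀ e ∈ H.edgeSet, #(H.edgeNhd e) < Fintype.card V)
    (hS : ∀ x y, H.localWeight x = H.localWeight y)
    (hm : 10 * #H.edgeFinset ≤ 9 * Fintype.card V) :
    ∃ l : ℕ, #H.edgeFinset * (l + 1) = Fintype.card V * l ∧
      ∀ C : H.ConnectedComponent,
        Nonempty (C.toSimpleGraph ≃g completeBipartiteGraph (Fin 1) (Fin l)) := by
  have hn : 0 < Fintype.card V := Fintype.card_pos
  by_cases h0 : ∃ x, H.degree x = 0
  · obtain ⟨x, hx⟩ := h0
    have h0' : ∀ y, H.degree y = 0 := fun y => by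
      rw [← localWeight_eq_zero_iff hc, hS y x, localWeight_eq_zero_iff hc, hx]
    refine ⟨0, ?_, ?_⟩
    · have := H.sum_degrees_eq_twice_card_edges
      simp only [h0', sum_const_zero] at this
      omega
    · intro C
      induction C using ConnectedComponent.ind with
      | _ v =>
      have h1 : ∀ x, H.Adj v x → H.degree x = 1 := fun x hvx =>
        absurd (h0' v) (Nat.pos_iff_ne_zero.1 ((H.degree_pos_iff_exists_adj v).2 ⟨x, hvx⟩))
      rw [← h0' v]
      exact ConnectedComponent.nonempty_iso_star h1
  push Not at h0
  have hstar : ∀ x y z, H.degree x = 1 → H.Adj x y → H.Adj y z → H.degree z = 1 :=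
    fun x y z => degree_eq_one_of_adj_adj hc (hS x y)
  obtain ⟨x₀, hx₀⟩ : ∃ x, H.degree x = 1 := by
    -- Minimum degree 2 would give $|E(H)|\ge n$.
    by_contra! h1
    have h2 : ∀ x ∈ (univ : Finset V), 2 ≤ H.degree x := fun x _ => by
      have := h0 x
      have := h1 x
      omega
    have h3 := card_nsmul_le_sum _ _ _ h2
    rw [H.sum_degrees_eq_twice_card_edges, card_univ, smul_eq_mul] at h3
    omega
  obtain ⟨y₀, hxy₀⟩ := (H.degree_pos_iff_exists_adj x₀).1 (by omega)
  obtain ⟨l, hl⟩ : ∃ l, H.degree y₀ = l := ⟨_, rfl⟩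
  have hlt : ∀ x y, H.degree x = 1 → H.Adj x y → H.degree y + 1 < Fintype.card V := by
    intro x y hx hxy
    rw [← card_edgeNhd_of_degree_eq_one hxy.symm hx]
    exact hc _ hxy.symm
  have hln : l + 1 < Fintype.card V := hl ▸ hlt x₀ y₀ hx₀ hxy₀
  have hln' : (l : ℚ) + 1 < Fintype.card V := by exact_mod_cast hln
  have hSl : ∀ x, H.localWeight x = l / ((Fintype.card V : ℚ) - l - 1) := by
    intro x
    rw [hS x x₀, localWeight_of_degree_eq_one hx₀ hxy₀ fun z => hstar x₀ y₀ z hx₀ hxy₀, hl]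
  have hdeg : ∀ x y, H.degree x = 1 → H.Adj x y → H.degree y = l := by
    intro x y hx hxy
    have h1 := hSl x
    have h2 : (H.degree y : ℚ) + 1 < Fintype.card V := by exact_mod_cast hlt x y hx hxy
    rw [localWeight_of_degree_eq_one hx hxy fun z => hstar x y z hx hxy,
      div_eq_div_iff (by linarith) (by linarith)] at h1
    have h3 : ((H.degree y : ℚ) - l) * ((Fintype.card V : ℚ) - 1) = 0 := by linarith
    rcases mul_eq_zero.1 h3 with h | h
    · exact_mod_cast sub_eq_zero.1 h
    · have : (0 : ℚ) ≤ l := Nat.cast_nonneg l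
      linarith
  set L : Finset V := {x | H.degree x = 1} with hL
  set Z : Finset V := {y | ∃ x, H.degree x = 1 ∧ H.Adj x y} with hZ
  have hmL : ∀ {x}, x ∈ L ↔ H.degree x = 1 := by simp [hL]
  have hmZ : ∀ {y}, y ∈ Z ↔ ∃ x, H.degree x = 1 ∧ H.Adj x y := by simp [hZ]
  set Q : Finset V := (L ∪ Z)ᶜ with hQdef
  have hmQ : ∀ {x}, x ∈ Q ↔ x ∉ L ∧ x ∉ Z := by simp [hQdef]
  rcases Q.eq_empty_or_nonempty with hQ0 | hQ0
  · have hcov : ∀ x, x ∈ L ∨ x ∈ Z := by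
      intro x
      by_contra! h
      exact notMem_empty x (hQ0 ▸ hmQ.2 h)
    refine ⟨l, ?_, ?_⟩
    -- Summing local weights over vertices and over edges gives $nl=|E(H)|(l+1)$ directly. This also
    -- covers $l=1$, where leaves and centres coincide.
    · have hw : ∀ e ∈ H.edgeFinset, #(H.edgeNhd e) * H.edgeWeight e
          = (l + 1) / ((Fintype.card V : ℚ) - l - 1) := by
        intro e he
        obtain ⟨y, z, hyz, hz, hy, rfl⟩ : ∃ y z, H.Adj y z ∧ H.degree z = 1 ∧
            H.degree y = l ∧ e = s(y, z) := by
          induction e with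
          | _ a b =>
          rw [mem_edgeFinset, mem_edgeSet] at he
          rcases hcov a with ha | ha
          · exact ⟨b, a, he.symm, hmL.1 ha, hdeg a b (hmL.1 ha) he, Sym2.eq_swap⟩
          · obtain ⟨x, hx, hxa⟩ := hmZ.1 ha
            exact ⟨a, b, he, hstar x a b hx hxa he, hdeg x a hx hxa, rfl⟩
        rw [edgeWeight, card_edgeNhd_of_degree_eq_one hyz hz, hy]
        push_cast
        rw [mul_one_div, sub_sub]
      have h1 := H.sum_localWeight
      rw [sum_congr rfl hw, sum_congr rfl fun x _ => hSl x, sum_const, sum_const, nsmul_eq_mul,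
        nsmul_eq_mul, card_univ, mul_div_assoc', mul_div_assoc',
        div_left_inj' (by linarith)] at h1
      exact_mod_cast h1.symm
    · intro C
      obtain ⟨y, rfl, hy, hyz⟩ : ∃ y, C = H.connectedComponentMk y ∧ H.degree y = l ∧
          ∀ z, H.Adj y z → H.degree z = 1 := by
        induction C using ConnectedComponent.ind with
        | _ v =>
        rcases hcov v with hv | hv
        · obtain ⟨y, hy⟩ := (H.degree_pos_iff_exists_adj v).1 (by have := hmL.1 hv; omega)
          exact ⟨y, ConnectedComponent.sound hy.reachable, hdeg v y (hmL.1 hv) hy,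
            fun z => hstar v y z (hmL.1 hv) hy⟩
        · obtain ⟨x, hx, hxv⟩ := hmZ.1 hv
          exact ⟨v, rfl, hdeg x v hx hxv, fun z => hstar x v z hx hxv⟩
      rw [← hy]
      exact ConnectedComponent.nonempty_iso_star hyz
  · exfalso
    have hclosed : ∀ x ∈ Q, ∀ y, H.Adj x y → y ∈ Q := by
      intro x hx y hxy
      rw [hmQ, hmL, hmZ] at hx ⊢
      refine ⟨fun hy => hx.2 ⟨y, hy, hxy.symm⟩, ?_⟩
      rintro ⟨z, hz, hzy⟩
      exact hx.1 (hstar z y x hz hzy hxy.symm)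
    have hQ2 : ∀ x ∈ Q, 2 ≤ H.degree x := by
      intro x hx
      rw [hmQ, hmL] at hx
      have := h0 x
      omega
    obtain ⟨x, hx, hk⟩ := exists_lt_card_edgesNear hQ0 hclosed hQ2 hln hSl
    have hbound := card_add_le_of_lt_card_edgesNear hc hclosed hQ2 hln hx (hSl x) hk
    have hQ3 : 3 ≤ #Q := by
      have hsub : insert x (H.neighborFinset x) ⊆ Q := by
        intro t ht
        rw [mem_insert, mem_neighborFinset] at ht
        rcases ht with rfl | ht
        · exact hx
        · exact hclosed x hx t ht
      have := card_le_card hsub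
      rw [card_insert_of_notMem (by simp), card_neighborFinset_eq_degree] at this
      have := hQ2 x hx
      omega
    have hl3 : 2 ≤ l := by
      by_contra! h
      interval_cases l <;> omega
    -- Centres have degree $l\ge2$, so they are not leaves.
    have hLZ : Disjoint L Z := by
      rw [Finset.disjoint_left]
      intro t ht htZ
      obtain ⟨z, hz, hzt⟩ := hmZ.1 htZ
      have := hdeg z t hz hzt
      have := hmL.1 ht
      omega
    have hLc : #L = #Z * l := card_degree_eq_one_eq_mul hstar hdeg
    have hcard : Fintype.card V = #Z * (l + 1) + #Q := by
      rw [← card_add_card_compl (L ∪ Z), card_union_of_disjoint hLZ, hLc]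
      ring
    have hsum : 2 * #H.edgeFinset = 2 * (#Z * l) + ∑ x ∈ Q, H.degree x := by
      rw [← H.sum_degrees_eq_twice_card_edges, ← sum_add_sum_compl (L ∪ Z), sum_union hLZ,
        sum_congr rfl fun x hx => hmL.1 hx,
        sum_congr (s₁ := Z) rfl fun y hy =>
          (show H.degree y = l from let ⟨z, hz, hzy⟩ := hmZ.1 hy; hdeg z y hz hzy),
        sum_const, sum_const, hLc]
      simp only [smul_eq_mul]
      ring
    have hR : 2 * #Q ≤ ∑ x ∈ Q, H.degree x := by
      have := card_nsmul_le_sum _ _ _ hQ2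
      rw [smul_eq_mul] at this
      omega
    obtain ⟨hR2, hq3⟩ := two_regular_of_card_bounds hcard hsum hR hm hbound hQ3
    have hreg : ∀ y ∈ Q, H.degree y = 2 := by
      have h2 : ∑ _y ∈ Q, 2 = ∑ y ∈ Q, H.degree y := by
        rw [hR2, sum_const, smul_eq_mul, mul_comm]
      exact fun y hy => ((sum_eq_sum_iff_of_le hQ2).1 h2 y hy).symm
    have hk4 := card_edgesNear_le_of_degree_eq_two (hreg x hx) fun y hy =>
      hreg y (hclosed x hx y hy)
    have hk3 := card_edgesNear_le_of_card_eq_three hclosed (hq3 (by omega)) hx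
    have hl2 : l = 2 := by omega
    rw [hl2] at hcard hbound
    have hZ0 : 0 < #Z := card_pos.2 ⟨y₀, hmZ.2 ⟨x₀, hx₀, hxy₀⟩⟩
    -- For $l=2$ the bound gives $n\le3$, while one star and $Q$ already have at least 6 vertices.
    omega

end Stars

/-! ### The main theorem and the counterexample. -/

section Main

variable {V : Type*} [Fintype V]

theorem exists_star_of_graphBetweenness_le {G : SimpleGraph V} (hG : G.Connected)
    (hU : G.IsBetweennessUniform) (hα : G.graphBetweenness ≤ 9 / 10) :
    ∃ l : ℕ, G.graphBetweenness = (l : ℚ) / ((l : ℚ) + 1) ∧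
      ∀ C : Gᶜ.ConnectedComponent,
        Nonempty (C.toSimpleGraph ≃g completeBipartiteGraph (Fin 1) (Fin l)) := by
  classical
  have := hG.nonempty
  have hn : (0 : ℚ) < Fintype.card V := by exact_mod_cast Fintype.card_pos
  have hs : ∑ x, G.vertexBetweenness x ≤ 9 / 10 * Fintype.card V := (div_le_iff₀ hn).1 hα
  have hd : ∀ v w, G.dist v w ≤ 2 := dist_le_two hG (by linarith)
  obtain ⟨H, hH⟩ : ∃ H, H = Gᶜ := ⟨_, rfl⟩
  have hm := sum_vertexBetweenness hH hG hd
  obtain ⟨l, hl, hC⟩ := stars_of_localWeight_eq (H := H)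
    (by rw [hH]; exact fun e he => card_edgeNhd_compl_lt hG hd he)
    (fun x y => by
      have := hU x y
      rw [vertexBetweenness_eq hH hG hd, vertexBetweenness_eq hH hG hd] at this
      linarith)
    (by
      rw [hm] at hs
      have : (10 : ℚ) * H.edgeFinset.card ≤ 9 * Fintype.card V := by linarith
      exact_mod_cast this)
  refine ⟨l, ?_, hH ▸ hC⟩
  rw [graphBetweenness, hm, div_eq_div_iff hn.ne' (by positivity)]
  have : (H.edgeFinset.card : ℚ) * (l + 1) = Fintype.card V * l := by exact_mod_cast hl
  linarith

end Main

end SimpleGraph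

theorem theorem1 :
    (∀ (V : Type*) [Fintype V] (G : SimpleGraph V) (α : ℚ),
      G.Connected → G.IsBetweennessUniform → G.graphBetweenness = α → α ≤ 9 / 10 →
      ∃ ℓ : ℕ, α = (ℓ : ℚ) / ((ℓ : ℚ) + 1) ∧
        ∀ C : Gᶜ.ConnectedComponent,
          Nonempty (C.toSimpleGraph ≃g completeBipartiteGraph (Fin 1) (Fin ℓ))) ∧
    ¬ (∀ q : ℚ, 3 / 4 < q →
      ∃ (n : ℕ) (G : SimpleGraph (Fin n)),
        G.Connected ∧ G.IsBetweennessUniform ∧ G.graphBetweenness = q) := by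
  refine ⟨fun V _ G α hG hU hα hle => ?_, fun h => ?_⟩
  · subst hα
    exact SimpleGraph.exists_star_of_graphBetweenness_le hG hU hle
  -- $7/9$ lies between $3/4$ and $9/10$, and $7/9=l/(l+1)$ would mean $2l=7$.
  · obtain ⟨n, G, hG, hU, hq⟩ := h (7 / 9) (by norm_num)
    obtain ⟨l, hl, -⟩ := SimpleGraph.exists_star_of_graphBetweenness_le hG hU
      (by rw [hq]; norm_num)
    rw [hq, div_eq_div_iff (by norm_num) (by positivity)] at hl
    have : 7 * (l + 1) = l * 9 := by exact_mod_cast hl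
    omega
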